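/- **Puncturings of low-bias linear codes are locally similar to random linear codes.** *Definitions.* Let $\mathbb F_q$ be the finite field of order $q$ and characteristic $p$, and let $n,m,b$ be nonnegative integers. All codes are linear, i.e. linear subspaces. - A property $\mathcal P$ over $\mathbb F_q^n$ is a set of linear codes $\mathcal C\subseteq\mathbb F_q^n$; the members are said to satisfy $\mathcal P$. It is *monotone-increasing* if it is upward closed under containment; *row-symmetric* if it is preserved by every permutation of the $n$ coordinates; *$b$-local* if there is a family $\mathcal B$ of subsets of $\mathbb F_q^n$ of size at most $b$ such that, for every linear code $\mathcal C$, $\mathcal C$ satisfies $\mathcal P$ if and only if $B\subseteq\mathcal C$ for some $B\in\mathcal B$. - A random linear code of length $n$ and rate $R=k/n$ is the row span of a uniformly random matrix in $\mathbb F_q^{k\times n}$. The threshold $\mathrm{RLC}(\mathcal P)$ is the least $R\in[0,1]$ with $Rn$ an integer such that a random linear code of length $n$ and rate $R$ satisfies $\mathcal P$ with probability at least $\tfrac12$ (and $1$ if there is no such $R$). - A linear code $\mathcal D\subseteq\mathbb F_q^m$ is *$\eta$-biased* if $\bigl|\sum_{i=1}^m e^{\frac{2\pi \mathrm i}{p}\mathrm{tr}(a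 u_i)}\bigr|\le m\eta$ for every $u\in\mathcal D\setminus\{0\}$ and every $a\in\mathbb F_q\setminus\{0\}$, where $\mathrm{tr}:\mathbb F_q\to\mathbb F_p$ is the field trace. - A *random $n$-puncturing* of $\mathcal D$ is the code $\{(u_{i_1},\dots,u_{i_n}) : u\in\mathcal D\}$ with $i_1,\dots,i_n$ independent and uniform in $\{1,\dots,m\}$. Its *design rate* is $\frac{\log_q|\mathcal D|}{n}$. *Theorem.* Let $w:\mathbb N\to\mathbb R$ satisfy $w(n)\to\infty$. Then there is a function $\delta:\mathbb N\to\mathbb R$, depending only on $w$, with $\delta(n)\to0$ as $n\to\infty$, such that the following holds for every prime power $q$, all $n,m,b$ and every $\varepsilon>0$. Let $\mathcal P$ be a monotone-increasing, row-symmetric and $b$-local property over $\mathbb F_q^n$, where $$\frac{n}{\log n}\ \ge\ w(n)\,q^{2b}.$$ Let $\mathcal D\subseteq\mathbb F_q^m$ be a linear code that is $\left(\frac{\varepsilon b\ln q}{q^b}\right)$-biased, and let $\mathcal C$ be a random $n$-puncturing of $\mathcal D$ whose design rate $R$ satisfies $R\le \mathrm{RLC}(\mathcal P)-2\varepsilon$.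 Then $$\Pr[\mathcal C\text{ satisfies }\mathcal P]\ \le\ q^{-(\varepsilon-\delta(n))\,n}.$$ -/

import Mathlib

open Filter Topology

namespace PuncturedCodes

noncomputable section

/-- The probability of the event `E` when `ω` is sampled uniformly from the finite set `Ω`. -/
def uniformProb {Ω : Type*} [Fintype Ω] (E : Ω → Prop) : ℝ :=
  (Nat.card {ω : Ω // E ω} : ℝ) / (Fintype.card Ω : ℝ)

section Codes

variable {F : Type*} [Field F]

/-- The code `φ(D)`, where `φ(u) = (u_{i_1}, …, u_{i_n})` is the puncturing map given by the
coordinates `i : Fin n → Fin m`. -/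
def puncture {m n : ℕ} (D : Submodule F (Fin m → F)) (i : Fin n → Fin m) :
    Submodule F (Fin n → F) :=
  D.map (LinearMap.funLeft F F i)

/-- The design rate `log_q |D| / n` of an `n`-puncturing of `D`. -/
def designRate [Fintype F] {m : ℕ} (D : Submodule F (Fin m → F)) (n : ℕ) : ℝ :=
  Real.logb (Fintype.card F) (Nat.card D) / n

/-- The probability that a random `n`-puncturing of `D` satisfies `P`: the `n` coordinates are
i.i.d. uniform in `[m]`, that is, the coordinate map is uniform among all `Fin n → Fin m`. -/
def puncturingProb {m n : ℕ} (D : Submodule F (Fin m → F))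
    (P : Set (Submodule F (Fin n → F))) : ℝ :=
  uniformProb fun i : Fin n → Fin m => puncture D i ∈ P

/-- The additive character `x ↦ ω ^ tr(x)` of a finite field of characteristic `p`, where
`ω = exp(2πi/p)` and `tr` is the trace to the prime field. -/
def traceChar (x : F) : ℂ :=
  letI : Algebra (ZMod (ringChar F)) F := ZMod.algebra F (ringChar F)
  Complex.exp (2 * Real.pi * Complex.I / (ringChar F : ℂ)) ^
    (Algebra.trace (ZMod (ringChar F)) F x).val

/-- `u ∈ F^m` is `η`-biased: `|∑ᵢ ω ^ tr(a uᵢ)| ≤ m η` for every `a ∈ F \ {0}`. -/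
def IsBiasedVec {m : ℕ} (η : ℝ) (u : Fin m → F) : Prop :=
  ∀ a : F, a ≠ 0 → ‖∑ i, traceChar (a * u i)‖ ≤ m * η

/-- A linear code is `η`-biased if all its nonzero codewords are. -/
def IsBiased {m : ℕ} (η : ℝ) (D : Submodule F (Fin m → F)) : Prop :=
  ∀ u ∈ D, u ≠ 0 → IsBiasedVec η u

/-- `P` is `b`-local: there is a family `𝓑` of sets of at most `b` words such that a linear code
satisfies `P` if and only if it contains some member of `𝓑`. -/
def IsLocal {n : ℕ} (b : ℕ) (P : Set (Submodule F (Fin n → F))) : Prop :=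
  ∃ 𝓑 : Set (Finset (Fin n → F)), (∀ B ∈ 𝓑, B.card ≤ b) ∧
    ∀ C : Submodule F (Fin n → F), C ∈ P ↔ ∃ B ∈ 𝓑, (B : Set (Fin n → F)) ⊆ C

/-- `P` is row-symmetric: it is preserved by permuting the `n` coordinates of a code. -/
def IsRowSymmetric {n : ℕ} (P : Set (Submodule F (Fin n → F))) : Prop :=
  ∀ C ∈ P, ∀ π : Equiv.Perm (Fin n), C.map (LinearMap.funLeft F F π) ∈ P

/-- The probability that a random linear code of length `n` and design dimension `k`, the row span
of a uniformly random `k × n` matrix, satisfies `P`. -/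
def rlcProb [Fintype F] {n : ℕ} (k : ℕ) (P : Set (Submodule F (Fin n → F))) : ℝ :=
  uniformProb fun G : Fin k → Fin n → F => Submodule.span F (Set.range G) ∈ P

/-- The threshold `RLC(P)`: the least `R ∈ [0,1]`, with `R n` an integer, such that a random linear
code of rate `R` satisfies `P` with probability at least `1/2`. It is `1` if there is no such `R`. -/
def rlcThreshold [Fintype F] {n : ℕ} (P : Set (Submodule F (Fin n → F))) : ℝ :=
  sInf (insert 1 {R : ℝ | R ∈ Set.Icc (0 : ℝ) 1 ∧ ∃ k : ℕ, (k : ℝ) = R * n ∧ 1 / 2 ≤ rlcProb k P})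

end Codes

end

end PuncturedCodes

namespace PuncturedCodes

open Finset
open scoped Classical

section Counting

theorem uniformProb_eq {Ω : Type*} [Fintype Ω] (E : Ω → Prop) [DecidablePred E] :
    uniformProb E = (#{ω | E ω} : ℝ) / Fintype.card Ω := by
  rw [uniformProb, Nat.card_eq_fintype_card, Fintype.card_subtype]

theorem card_comp_eq {α β : Type*} [Fintype α] [DecidableEq β] {n : ℕ} (u : α → β) (M : Fin n → β) :
    #{i : Fin n → α | u ∘ i = M} = ∏ s, #{x : α | u x = M s} := by
  rw [← Fintype.card_piFinset]
  congr 1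
  ext i
  simp [funext_iff]

/-- The functions obtained from `M` by permuting its arguments. -/
noncomputable def permOrbit {n : ℕ} {V : Type*} (M : Fin n → V) : Finset (Fin n → V) :=
  univ.image fun π : Equiv.Perm (Fin n) => M ∘ π

theorem mem_permOrbit {n : ℕ} {V : Type*} {M N : Fin n → V} :
    N ∈ permOrbit M ↔ ∃ π : Equiv.Perm (Fin n), M ∘ π = N := by
  simp [permOrbit]

theorem card_permOrbit_pos {n : ℕ} {V : Type*} (M : Fin n → V) : 0 < #(permOrbit M) :=
  card_pos.2 ⟨M, mem_permOrbit.2 ⟨1, rfl⟩⟩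

theorem comp_perm_mem_permOrbit {n : ℕ} {V : Type*} {M N : Fin n → V} (h : N ∈ permOrbit M)
    (π : Equiv.Perm (Fin n)) : N ∘ π ∈ permOrbit M := by
  obtain ⟨σ, rfl⟩ := mem_permOrbit.1 h
  exact mem_permOrbit.2 ⟨σ * π, rfl⟩

theorem card_permOrbit_fiber_mul_le {n : ℕ} {V W : Type*} [DecidableEq W] (φ : V → W)
    (M : Fin n → V) (N : Fin n → W) :
    #{M' ∈ permOrbit M | φ ∘ M' = N} * #(permOrbit (φ ∘ M)) ≤ #(permOrbit M) := by
  have maps : Set.MapsTo (fun M' : Fin n → V => φ ∘ M') (permOrbit M) (permOrbit (φ ∘ M)) := by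
    intro M' h
    obtain ⟨σ, rfl⟩ := mem_permOrbit.1 h
    exact mem_permOrbit.2 ⟨σ, rfl⟩
  by_cases hN : N ∈ permOrbit (φ ∘ M)
  · rw [card_eq_sum_card_fiberwise maps, mul_comm, ← smul_eq_mul]
    refine card_nsmul_le_sum _ _ _ fun N' hN' => ?_
    obtain ⟨σ, rfl⟩ := mem_permOrbit.1 hN
    obtain ⟨τ, rfl⟩ := mem_permOrbit.1 hN'
    refine card_le_card_of_injOn (fun M' => M' ∘ ((σ⁻¹ * τ : Equiv.Perm (Fin n)))) ?_ ?_
    · intro M' h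
      simp only [coe_filter, Set.mem_ofPred_eq] at h ⊢
      refine ⟨comp_perm_mem_permOrbit h.1 _, ?_⟩
      rw [← Function.comp_assoc, h.2]
      ext i
      simp
    · intro M₁ _ M₂ _ h
      exact (Equiv.surjective _).injective_comp_right h
  · have : #{M' ∈ permOrbit M | φ ∘ M' = N} = 0 := by
      rw [card_eq_zero, filter_eq_empty_iff]
      rintro M' h rfl
      exact hN (maps h)
    simp [this]

end Counting

section Linear

variable {F : Type*} [Field F]

theorem card_linearMap_fiber {K V : Type*} [AddCommGroup K] [Module F K] [AddCommGroup V]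
    [Module F V] [Fintype K] [DecidableEq V] (T : K →ₗ[F] V) (x₀ : K) :
    #{x : K | T x = T x₀} = Nat.card (LinearMap.ker T) := by
  rw [Nat.card_eq_fintype_card, Fintype.card_subtype]
  refine card_bij' (fun x _ => x - x₀) (fun x _ => x + x₀) ?_ ?_ ?_ ?_ <;>
    simp +contextual

theorem card_linearMap_fiber_le {K V : Type*} [AddCommGroup K] [Module F K] [AddCommGroup V]
    [Module F V] [Fintype K] [DecidableEq V] (T : K →ₗ[F] V) (v : V) :
    #{x : K | T x = v} ≤ Nat.card (LinearMap.ker T) := by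
  by_cases h : ∃ x₀, T x₀ = v
  · obtain ⟨x₀, rfl⟩ := h
    exact (card_linearMap_fiber T x₀).le
  · rw [filter_eq_empty_iff.2 fun x _ hx => h ⟨x, hx⟩]
    simp

theorem card_ker_mul_card_range {K V : Type*} [AddCommGroup K] [Module F K] [AddCommGroup V]
    [Module F V] (T : K →ₗ[F] V) :
    Nat.card (LinearMap.ker T) * Nat.card (LinearMap.range T) = Nat.card K := by
  rw [Submodule.card_eq_card_quotient_mul_card (LinearMap.ker T),
    Nat.card_congr T.quotKerEquivRange.toEquiv]

theorem card_linearMap_eq {K V : Type*} [AddCommGroup K] [Module F K] [AddCommGroup V]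
    [Module F V] [Finite F] [Finite K] [Finite V] :
    Nat.card (K →ₗ[F] V) = Nat.card V ^ Module.finrank F K := by
  have : Module.Finite F K := Module.Finite.of_finite
  have : Module.Finite F V := Module.Finite.of_finite
  rw [Module.natCard_eq_pow_finrank (K := F), Module.natCard_eq_pow_finrank (K := F) (V := V),
    Module.finrank_linearMap, ← pow_mul, mul_comm]

theorem card_linearMap_range_le {K V : Type*} [AddCommGroup K] [Module F K] [AddCommGroup V]
    [Module F V] [Finite F] [Finite K] [Finite V] [Fintype (K →ₗ[F] V)] (H : Submodule F V) :
    #{T : K →ₗ[F] V | LinearMap.range T ≤ H} ≤ Nat.card H ^ Module.finrank F K := by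
  rw [← card_linearMap_eq (F := F) (K := K) (V := H), ← Fintype.card_subtype,
    ← Nat.card_eq_fintype_card]
  have : Finite (K →ₗ[F] H) := Module.finite_of_finite F
  refine Nat.card_le_card_of_injective
    (fun T => LinearMap.codRestrict H T.1 fun x => T.2 (LinearMap.mem_range_self _ x)) ?_
  intro T₁ T₂ h
  ext x
  exact congrArg Subtype.val (LinearMap.congr_fun h x)

theorem card_submodule_le {V : Type*} [AddCommGroup V] [Module F V] [Finite F] [Finite V] :
    Nat.card (Submodule F V) ≤ Nat.card V ^ Module.finrank F V := by
  rw [← card_linearMap_eq (F := F)]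
  have : Module.Finite F V := Module.Finite.of_finite
  have : Finite (V →ₗ[F] V) := Module.finite_of_finite F
  refine Nat.card_le_card_of_surjective (fun T : V →ₗ[F] V => LinearMap.range T) fun S => ?_
  obtain ⟨g, hg⟩ := S.subtype.exists_leftInverse_of_injective (by simp)
  refine ⟨S.subtype ∘ₗ g, ?_⟩
  have hs : LinearMap.range g = ⊤ :=
    LinearMap.range_eq_top.2 fun x => ⟨x, LinearMap.congr_fun hg x⟩
  simp [LinearMap.range_comp, hs]

theorem card_ker_of_ne_zero {V : Type*} [AddCommGroup V] [Module F V] (f : V →ₗ[F] F)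
    (hf : f ≠ 0) : Nat.card (LinearMap.ker f) * Nat.card F = Nat.card V := by
  rw [← card_ker_mul_card_range f, LinearMap.range_eq_top.2 (LinearMap.surjective hf)]
  simp

/-- All but a `|V| / |K|` fraction of the linear maps `K → V` are surjective. -/
theorem card_not_surjective_le {K V : Type*} [AddCommGroup K] [Module F K] [AddCommGroup V]
    [Module F V] [Finite F] [Finite K] [Finite V] [Fintype (K →ₗ[F] V)] :
    #{T : K →ₗ[F] V | ¬ Function.Surjective T} * Nat.card K ≤
      Nat.card V * Nat.card V ^ Module.finrank F K := by
  have : Module.Finite F V := Module.Finite.of_finite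
  have : Finite (V →ₗ[F] F) := Module.finite_of_finite F
  have := Fintype.ofFinite (V →ₗ[F] F)
  have hsub : ({T : K →ₗ[F] V | ¬ Function.Surjective T} : Finset (K →ₗ[F] V)) ⊆
      ({f : V →ₗ[F] F | f ≠ 0} : Finset _).biUnion
        fun f => {T : K →ₗ[F] V | LinearMap.range T ≤ LinearMap.ker f} := by
    intro T hT
    simp only [mem_filter, mem_univ, true_and, mem_biUnion] at hT ⊢
    exact Submodule.exists_le_ker_of_lt_top _ (lt_top_iff_ne_top.2 fun h =>
      hT (LinearMap.range_eq_top.1 h))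
  have hK : Nat.card K = Nat.card F ^ Module.finrank F K :=
    have : Module.Finite F K := Module.Finite.of_finite
    Module.natCard_eq_pow_finrank
  calc _ ≤ (∑ f ∈ ({f : V →ₗ[F] F | f ≠ 0} : Finset _),
        #{T : K →ₗ[F] V | LinearMap.range T ≤ LinearMap.ker f}) * Nat.card K :=
        Nat.mul_le_mul_right _ ((card_le_card hsub).trans card_biUnion_le)
    _ = ∑ f ∈ ({f : V →ₗ[F] F | f ≠ 0} : Finset _),
        #{T : K →ₗ[F] V | LinearMap.range T ≤ LinearMap.ker f} * Nat.card K := by rw [sum_mul]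
    _ ≤ ∑ f ∈ ({f : V →ₗ[F] F | f ≠ 0} : Finset _), Nat.card V ^ Module.finrank F K := by
        refine sum_le_sum fun f hf => ?_
        rw [hK, ← card_ker_of_ne_zero f (mem_filter.1 hf).2, mul_pow]
        exact Nat.mul_le_mul_right _ (card_linearMap_range_le _)
    _ ≤ Nat.card V * Nat.card V ^ Module.finrank F K := by
        rw [sum_const, smul_eq_mul]
        refine Nat.mul_le_mul_right _ ((card_le_univ _).trans ?_)
        rw [← Nat.card_eq_fintype_card, Module.natCard_eq_pow_finrank (K := F),
          Module.natCard_eq_pow_finrank (K := F) (V := V), Module.finrank_linearMap]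
        simp

end Linear

section SecondMoment

variable {F K V : Type*} [Field F] [AddCommGroup K] [Module F K] [AddCommGroup V] [Module F V]

theorem card_pairs_mul_le [Fintype V] {n : ℕ} (M : Fin n → V) (S : Submodule F (V × V)) :
    #{M' : Fin n → V × V | Prod.fst ∘ M' ∈ permOrbit M ∧ Prod.snd ∘ M' ∈ permOrbit M ∧
        ∀ i, M' i ∈ S} * #(permOrbit ((S.comap (LinearMap.inr F V V)).mkQ ∘ M)) ≤
      #(permOrbit M) ^ 2 := by
  set U := S.comap (LinearMap.inr F V V) with hU
  rw [card_eq_sum_card_fiberwise (f := fun M' : Fin n → V × V => Prod.fst ∘ M')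
    (t := permOrbit M) (fun M' h => (mem_filter.1 h).2.1), sum_mul, sq, ← smul_eq_mul (#_)]
  refine sum_le_card_nsmul _ _ _ fun M₁ _ => ?_
  set A := filter (fun M' : Fin n → V × V => Prod.fst ∘ M' = M₁)
    {M' : Fin n → V × V | Prod.fst ∘ M' ∈ permOrbit M ∧ Prod.snd ∘ M' ∈ permOrbit M ∧
        ∀ i, M' i ∈ S} with hA
  rcases A.eq_empty_or_nonempty with h | ⟨N, hN⟩
  · simp [h]
  refine le_trans (Nat.mul_le_mul_right _ ?_)
    (card_permOrbit_fiber_mul_le U.mkQ M (U.mkQ ∘ Prod.snd ∘ N))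
  simp only [hA, mem_filter, mem_univ, true_and] at hN
  refine card_le_card_of_injOn (fun M' => Prod.snd ∘ M') ?_ ?_
  · intro M' h
    simp only [hA, coe_filter, mem_filter, mem_univ, true_and, Set.mem_ofPred_eq] at h ⊢
    refine ⟨h.1.2.1, funext fun i => ?_⟩
    have h1 : (M' i).1 = (N i).1 := congrFun (h.2.trans hN.2.symm) i
    have h2 := S.sub_mem (h.1.2.2 i) (hN.1.2.2 i)
    simp only [Function.comp_apply, Submodule.mkQ_apply]
    rw [Submodule.Quotient.eq, hU, Submodule.mem_comap]
    convert h2 using 1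
    ext <;> simp [h1]
  · intro M₁' h1 M₂' h2 h
    simp only [hA, coe_filter, mem_filter, mem_univ, true_and, Set.mem_ofPred_eq] at h1 h2
    funext i
    exact Prod.ext (congrFun (h1.2.trans h2.2.symm) i) (congrFun h i)

theorem card_pair_event_mul_le [Fintype K] [Fintype V] {n : ℕ} (M : Fin n → V)
    (T : K →ₗ[F] V × V) :
    #{G : Fin n → K | Prod.fst ∘ T ∘ G ∈ permOrbit M ∧ Prod.snd ∘ T ∘ G ∈ permOrbit M} *
        (#(permOrbit (((LinearMap.range T).comap (LinearMap.inr F V V)).mkQ ∘ M)) *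
          Nat.card (LinearMap.range T) ^ n) ≤
      #(permOrbit M) ^ 2 * Nat.card K ^ n := by
  set S := LinearMap.range T with hS
  set B : Finset (Fin n → V × V) := {M' : Fin n → V × V | Prod.fst ∘ M' ∈ permOrbit M ∧
    Prod.snd ∘ M' ∈ permOrbit M ∧ ∀ i, M' i ∈ S} with hB
  set A : Finset (Fin n → K) := {G : Fin n → K | Prod.fst ∘ T ∘ G ∈ permOrbit M ∧
    Prod.snd ∘ T ∘ G ∈ permOrbit M} with hA
  have maps : ∀ G ∈ A, T ∘ G ∈ B := by
    intro G h
    rw [hA, mem_filter] at h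
    rw [hB, mem_filter]
    exact ⟨mem_univ _, h.2.1, h.2.2, fun i => LinearMap.mem_range_self _ _⟩
  have key : #A ≤ Nat.card (LinearMap.ker T) ^ n * #B := by
    refine card_le_mul_card_image_of_maps_to (f := fun G : Fin n → K => T ∘ G) maps _ fun M' _ => ?_
    calc _ ≤ #{G : Fin n → K | T ∘ G = M'} :=
          card_le_card (filter_subset_filter _ (subset_univ _))
      _ = ∏ s, #{x : K | T x = M' s} := card_comp_eq _ _
      _ ≤ ∏ _s : Fin n, Nat.card (LinearMap.ker T) :=
          prod_le_prod' fun s _ => card_linearMap_fiber_le T _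
      _ = _ := by simp
  calc _ ≤ _ := Nat.mul_le_mul_right _ key
    _ = (#B * #(permOrbit ((S.comap (LinearMap.inr F V V)).mkQ ∘ M))) *
        (Nat.card (LinearMap.ker T) * Nat.card S) ^ n := by ring
    _ ≤ _ := by
      rw [card_ker_mul_card_range]
      exact Nat.mul_le_mul_right _ (card_pairs_mul_le M S)

theorem card_event_of_surjective [Fintype K] {n : ℕ} (M : Fin n → V)
    (T : K →ₗ[F] V) (hT : Function.Surjective T) :
    #{G : Fin n → K | T ∘ G ∈ permOrbit M} * Nat.card V ^ n =
      #(permOrbit M) * Nat.card K ^ n := by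
  have h : #{G : Fin n → K | T ∘ G ∈ permOrbit M} =
      #(permOrbit M) * Nat.card (LinearMap.ker T) ^ n := by
    have maps : Set.MapsTo (fun G : Fin n → K => T ∘ G)
        ({G : Fin n → K | T ∘ G ∈ permOrbit M} : Finset _) (permOrbit M) :=
      fun G hG => (mem_filter.1 hG).2
    rw [card_eq_sum_card_fiberwise maps, ← smul_eq_mul]
    refine sum_eq_card_nsmul fun M' hM' => ?_
    have : filter (fun G : Fin n → K => T ∘ G = M') {G : Fin n → K | T ∘ G ∈ permOrbit M} =
        ({G : Fin n → K | T ∘ G = M'} : Finset _) := by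
      ext G
      simp only [mem_filter, mem_univ, true_and, and_iff_right_iff_imp]
      rintro rfl
      exact hM'
    refine (congrArg card this).trans ?_
    rw [card_comp_eq]
    have : ∀ s, #{x : K | T x = M' s} = Nat.card (LinearMap.ker T) := fun s => by
      obtain ⟨x₀, hx⟩ := hT (M' s)
      rw [← hx]
      exact card_linearMap_fiber T x₀
    simp [this]
  have h2 := card_ker_mul_card_range T
  rw [LinearMap.range_eq_top.2 hT, Nat.card_congr Submodule.topEquiv.toEquiv] at h2
  rw [h, ← h2]
  ring

/-- A subspace `S` of `V × V` projecting onto the first factor has `|V| |S ∩ (0 × V)|` elements. -/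
theorem card_mul_card_comap_inr [Finite V] (S : Submodule F (V × V))
    (hS : ∀ v, ∃ w, (v, w) ∈ S) :
    Nat.card S = Nat.card V * Nat.card (S.comap (LinearMap.inr F V V)) := by
  set p : S →ₗ[F] V := LinearMap.fst F V V ∘ₗ S.subtype with hp
  have hsurj : Function.Surjective p := fun v => by
    obtain ⟨w, hw⟩ := hS v
    exact ⟨⟨(v, w), hw⟩, rfl⟩
  rw [← card_ker_mul_card_range p, LinearMap.range_eq_top.2 hsurj,
    Nat.card_congr Submodule.topEquiv.toEquiv, mul_comm]
  congr 1
  refine Nat.card_congr ⟨fun x => ⟨x.1.1.2, ?_⟩, fun v => ⟨⟨(0, v.1), v.2⟩, ?_⟩, ?_, ?_⟩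
  · obtain ⟨⟨⟨a, c⟩, hx⟩, hk⟩ := x
    have : a = 0 := hk
    subst this
    exact hx
  · exact rfl
  · rintro ⟨⟨⟨a, c⟩, hx⟩, hk⟩
    have : a = 0 := hk
    subst this
    rfl
  · intro v
    rfl

/-- The number of surjections `T : K → V` for which `T ∘ G` is a rearrangement of `M`. -/
noncomputable def surjHits [Fintype (K →ₗ[F] V)] {n : ℕ} (M : Fin n → V) (G : Fin n → K) : ℕ :=
  #{T : K →ₗ[F] V | Function.Surjective T ∧ T ∘ G ∈ permOrbit M}

theorem surjHits_eq_zero [Fintype (K →ₗ[F] V)] {n : ℕ} {M : Fin n → V} {G : Fin n → K}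
    (h : ¬ ∃ T : K →ₗ[F] V, Function.Surjective T ∧ T ∘ G ∈ permOrbit M) :
    surjHits (F := F) M G = 0 := by
  rw [surjHits, card_eq_zero, filter_eq_empty_iff]
  exact fun T _ hT => h ⟨T, hT⟩

theorem le_sum_surjHits [Finite F] [Fintype K] [Finite V] [Fintype (K →ₗ[F] V)] {n : ℕ}
    (M : Fin n → V) (hVK : 8 * Nat.card V ≤ Nat.card K) (hk : Module.finrank F K ≤ n) :
    7 * (#(permOrbit M) * Nat.card K ^ n) ≤
      8 * ((∑ G : Fin n → K, surjHits (F := F) M G) *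
        Nat.card V ^ (n - Module.finrank F K)) := by
  set k := Module.finrank F K with hk_def
  have hv : 0 < Nat.card V := Nat.card_pos
  have hswap : ∑ G : Fin n → K, surjHits (F := F) M G =
      ∑ T ∈ ({T : K →ₗ[F] V | Function.Surjective T} : Finset _),
        #{G : Fin n → K | T ∘ G ∈ permOrbit M} := by
    have := sum_card_bipartiteAbove_eq_sum_card_bipartiteBelow
      (fun (G : Fin n → K) (T : K →ₗ[F] V) => T ∘ G ∈ permOrbit M)
      (s := univ) (t := ({T : K →ₗ[F] V | Function.Surjective T} : Finset _))
    simp only [bipartiteAbove, bipartiteBelow, filter_filter] at this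
    exact this
  have hsum : (∑ G : Fin n → K, surjHits (F := F) M G) * Nat.card V ^ n =
      #{T : K →ₗ[F] V | Function.Surjective T} * (#(permOrbit M) * Nat.card K ^ n) := by
    rw [hswap, sum_mul, ← smul_eq_mul]
    exact sum_eq_card_nsmul fun T hT => card_event_of_surjective M T (mem_filter.1 hT).2
  have hnot : 8 * #{T : K →ₗ[F] V | ¬ Function.Surjective T} ≤ Nat.card V ^ k := by
    refine Nat.le_of_mul_le_mul_left ?_ hv
    refine le_trans ?_ (card_not_surjective_le (F := F) (K := K) (V := V))
    calc _ = #{T : K →ₗ[F] V | ¬ Function.Surjective T} * (8 * Nat.card V) := by ring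
      _ ≤ _ := Nat.mul_le_mul_left _ hVK
  have htot : #{T : K →ₗ[F] V | Function.Surjective T} +
      #{T : K →ₗ[F] V | ¬ Function.Surjective T} = Nat.card V ^ k := by
    rw [card_filter_add_card_filter_not, ← card_linearMap_eq (F := F), card_univ,
      Nat.card_eq_fintype_card]
  have hs : 7 * Nat.card V ^ k ≤ 8 * #{T : K →ₗ[F] V | Function.Surjective T} := by omega
  refine Nat.le_of_mul_le_mul_left ?_ (pow_pos hv k)
  calc _ = (7 * Nat.card V ^ k) * (#(permOrbit M) * Nat.card K ^ n) := by ring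
    _ ≤ (8 * #{T : K →ₗ[F] V | Function.Surjective T}) *
        (#(permOrbit M) * Nat.card K ^ n) := Nat.mul_le_mul_right _ hs
    _ = 8 * ((∑ G : Fin n → K, surjHits (F := F) M G) * Nat.card V ^ n) := by
      rw [hsum]; ring
    _ = _ := by
      have hp : Nat.card V ^ n = Nat.card V ^ k * Nat.card V ^ (n - k) := by
        rw [← pow_add, Nat.add_sub_cancel' hk]
      rw [hp]; ring

theorem sum_sq_surjHits_le [Fintype K] [Fintype V] [Fintype (K →ₗ[F] V)]
    [Fintype (K →ₗ[F] V × V)] {n : ℕ} (M : Fin n → V) :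
    ∑ G : Fin n → K, surjHits (F := F) M G ^ 2 ≤
      ∑ T ∈ ({T : K →ₗ[F] V × V | ∀ v, ∃ w, (v, w) ∈ LinearMap.range T} : Finset _),
        #{G : Fin n → K | Prod.fst ∘ T ∘ G ∈ permOrbit M ∧
          Prod.snd ∘ T ∘ G ∈ permOrbit M} := by
  have := sum_card_bipartiteAbove_eq_sum_card_bipartiteBelow
    (fun (G : Fin n → K) (T : K →ₗ[F] V × V) =>
      Prod.fst ∘ T ∘ G ∈ permOrbit M ∧ Prod.snd ∘ T ∘ G ∈ permOrbit M)
    (s := univ)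
    (t := ({T : K →ₗ[F] V × V | ∀ v, ∃ w, (v, w) ∈ LinearMap.range T} : Finset _))
  simp only [bipartiteAbove, bipartiteBelow, filter_filter] at this
  rw [← this]
  refine sum_le_sum fun G _ => ?_
  rw [sq, surjHits, ← card_product]
  refine card_le_card_of_injOn (fun T => T.1.prod T.2) ?_ ?_
  · rintro ⟨T₁, T₂⟩ h
    simp only [coe_product, coe_filter, mem_univ, true_and, Set.mem_prod,
      Set.mem_ofPred_eq] at h ⊢
    refine ⟨fun v => ?_, h.1.2, h.2.2⟩
    obtain ⟨x, rfl⟩ := h.1.1 v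
    exact ⟨T₂ x, x, rfl⟩
  · rintro ⟨T₁, T₂⟩ _ ⟨T₁', T₂'⟩ _ h
    have h' := fun x => LinearMap.congr_fun h x
    exact Prod.ext (LinearMap.ext fun x => congrArg Prod.fst (h' x))
      (LinearMap.ext fun x => congrArg Prod.snd (h' x))

theorem sum_pair_event_le [Finite F] [Fintype K] [Fintype V] [Fintype (K →ₗ[F] V × V)]
    [Fintype (Submodule F (V × V))] {n : ℕ} (M : Fin n → V) (hk : Module.finrank F K ≤ n)
    (hU : ∀ U : Submodule F V, U ≠ ⊤ → 2 * Nat.card (Submodule F (V × V)) *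
      Nat.card (V ⧸ U) ^ (n - Module.finrank F K) ≤ #(permOrbit (U.mkQ ∘ M))) :
    2 * ((∑ T ∈ ({T : K →ₗ[F] V × V | ∀ v, ∃ w, (v, w) ∈ LinearMap.range T} : Finset _),
        #{G : Fin n → K | Prod.fst ∘ T ∘ G ∈ permOrbit M ∧
          Prod.snd ∘ T ∘ G ∈ permOrbit M}) * Nat.card V ^ (2 * (n - Module.finrank F K))) ≤
      3 * (#(permOrbit M) ^ 2 * Nat.card K ^ n) := by
  set k := Module.finrank F K with hk_def
  set e := n - k with he
  have hn : n = k + e := (Nat.add_sub_cancel' hk).symm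
  set s := Nat.card (Submodule F (V × V)) with hs
  have hs0 : 0 < s := Nat.card_pos
  set R := #(permOrbit M) ^ 2 * Nat.card K ^ n with hR
  set X : (K →ₗ[F] V × V) → ℕ := fun T => #{G : Fin n → K | Prod.fst ∘ T ∘ G ∈ permOrbit M ∧
          Prod.snd ∘ T ∘ G ∈ permOrbit M} with hX
  set t : Finset (K →ₗ[F] V × V) := {T | ∀ v, ∃ w, (v, w) ∈ LinearMap.range T} with ht
  have hSe : ∀ S : Submodule F (V × V), (∀ v, ∃ w, (v, w) ∈ S) →
      Nat.card S * Nat.card (V ⧸ S.comap (LinearMap.inr F V V)) = Nat.card V ^ 2 := by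
    intro S h
    rw [card_mul_card_comap_inr S h, sq, mul_assoc,
      ← Submodule.card_eq_card_quotient_mul_card]
  have hTop : ∀ T ∈ t, X T * (Nat.card (LinearMap.range T) ^ n) ≤ R := by
    intro T _
    refine le_trans ?_ (card_pair_event_mul_le M T)
    exact Nat.mul_le_mul_left _ (Nat.le_mul_of_pos_left _ (card_permOrbit_pos _))
  have hT1 : ∀ T ∈ t, LinearMap.range T = ⊤ →
      X T * (2 * s * Nat.card V ^ (2 * e)) * Nat.card (LinearMap.range T) ^ k ≤
        2 * s * R := by
    intro T hT htop
    have h1 := hTop T hT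
    have h2 : Nat.card (LinearMap.range T) = Nat.card V ^ 2 := by
      rw [htop, Nat.card_congr Submodule.topEquiv.toEquiv, Nat.card_prod, sq]
    calc _ = 2 * s * (X T * Nat.card (LinearMap.range T) ^ n) := by
          rw [h2, hn, pow_add, pow_mul (Nat.card V) 2 e]; ring
      _ ≤ _ := Nat.mul_le_mul_left _ h1
  have hT2 : ∀ T ∈ t, LinearMap.range T ≠ ⊤ →
      X T * (2 * s * Nat.card V ^ (2 * e)) * Nat.card (LinearMap.range T) ^ k ≤ R := by
    intro T hT htop
    have hsur : ∀ v, ∃ w, (v, w) ∈ LinearMap.range T := (mem_filter.1 hT).2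
    set S := LinearMap.range T with hS
    set U := S.comap (LinearMap.inr F V V) with hU'
    have hne : U ≠ ⊤ := by
      intro h
      apply htop
      rw [eq_top_iff]
      rintro ⟨a, c⟩ -
      obtain ⟨w, hw⟩ := hsur a
      have : c - w ∈ U := h ▸ Submodule.mem_top
      have h3 := S.add_mem hw this
      simpa using h3
    refine le_trans ?_ (card_pair_event_mul_le M T)
    calc _ = X T * ((2 * s * Nat.card (V ⧸ U) ^ e) * Nat.card S ^ n) := by
          rw [hn, pow_add, pow_mul (Nat.card V) 2 e, ← hSe S hsur, mul_pow]; ring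
      _ ≤ _ := Nat.mul_le_mul_left _ (Nat.mul_le_mul_right _ (hU U hne))
  have hgroup : ∀ S : Submodule F (V × V), ∀ B : ℕ,
      (∀ T ∈ t, LinearMap.range T = S →
        X T * (2 * s * Nat.card V ^ (2 * e)) * Nat.card S ^ k ≤ B) →
      ∑ T ∈ t with LinearMap.range T = S, X T * (2 * s * Nat.card V ^ (2 * e)) ≤ B := by
    intro S B h
    have hc : #{T ∈ t | LinearMap.range T = S} ≤ Nat.card S ^ k := by
      refine le_trans (card_le_card ?_) (card_linearMap_range_le (K := K) S)
      intro T hT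
      simp only [mem_filter, mem_univ, true_and] at hT ⊢
      exact hT.2.le
    refine Nat.le_of_mul_le_mul_right ?_ (pow_pos (Nat.card_pos (α := S)) k)
    rw [sum_mul]
    refine le_trans (sum_le_card_nsmul _ _ B fun T hT => ?_) ?_
    · rw [mem_filter] at hT
      exact h T hT.1 hT.2
    · rw [smul_eq_mul, mul_comm]
      exact Nat.mul_le_mul_left _ hc
  have htotal : ∑ T ∈ t, X T * (2 * s * Nat.card V ^ (2 * e)) ≤ 2 * s * R + s * R := by
    rw [← sum_fiberwise (s := t) (g := fun T => LinearMap.range T),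
      ← add_sum_erase _ _ (mem_univ (⊤ : Submodule F (V × V)))]
    refine Nat.add_le_add ?_ ?_
    · exact hgroup ⊤ _ fun T hT h => h ▸ hT1 T hT h
    · refine le_trans (sum_le_card_nsmul _ _ R fun S hS => ?_) ?_
      · exact hgroup S _ fun T hT h => h ▸ hT2 T hT (h ▸ (mem_erase.1 hS).1)
      · rw [smul_eq_mul]
        refine Nat.mul_le_mul_right _ ((card_le_univ _).trans ?_)
        rw [hs, Nat.card_eq_fintype_card]
  rw [← sum_mul] at htotal
  refine Nat.le_of_mul_le_mul_left ?_ hs0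
  calc _ = (∑ T ∈ t, X T) * (2 * s * Nat.card V ^ (2 * e)) := by ring
    _ ≤ _ := htotal
    _ = _ := by ring

theorem lt_two_mul_of_moments {o N Y Z E c : ℕ} (ho : 0 < o) (hN : 0 < N)
    (hmean : 7 * (o * N) ≤ 8 * (Y * c)) (hZ : 2 * (Z * c ^ 2) ≤ 3 * (o ^ 2 * N))
    (hCS : Y ^ 2 ≤ E * Z) : N < 2 * E := by
  have hmain : 98 * N * (o ^ 2 * N) ≤ 192 * E * (o ^ 2 * N) := by
    calc 98 * N * (o ^ 2 * N) = 2 * (7 * (o * N)) ^ 2 := by ring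
      _ ≤ 2 * (8 * (Y * c)) ^ 2 := Nat.mul_le_mul_left _ (Nat.pow_le_pow_left hmean 2)
      _ = 128 * c ^ 2 * Y ^ 2 := by ring
      _ ≤ 128 * c ^ 2 * (E * Z) := Nat.mul_le_mul_left _ hCS
      _ = 64 * E * (2 * (Z * c ^ 2)) := by ring
      _ ≤ 64 * E * (3 * (o ^ 2 * N)) := Nat.mul_le_mul_left _ hZ
      _ = _ := by ring
  have := Nat.le_of_mul_le_mul_right hmain (by positivity)
  omega

/-- If a random `G : Fin n → K` rarely admits a surjection `T` carrying it to a rearrangement of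
`M`, then some nontrivial quotient of `M` has few rearrangements. -/
theorem exists_quotient_card_permOrbit_le [Finite F] [Fintype K] [Fintype V] {n : ℕ}
    (M : Fin n → V) (hVK : 8 * Nat.card V ≤ Nat.card K) (hk : Module.finrank F K ≤ n)
    (hG : uniformProb (fun G : Fin n → K =>
      ∃ T : K →ₗ[F] V, Function.Surjective T ∧ T ∘ G ∈ permOrbit M) < 1 / 2) :
    ∃ U : Submodule F V, U ≠ ⊤ ∧ #(permOrbit (U.mkQ ∘ M)) ≤
      2 * Nat.card (Submodule F (V × V)) * Nat.card (V ⧸ U) ^ (n - Module.finrank F K) := by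
  by_contra! hU
  have : Module.Finite F K := Module.Finite.of_finite
  have : Finite (K →ₗ[F] V) := Module.finite_of_finite F
  have : Finite (K →ₗ[F] V × V) := Module.finite_of_finite F
  have := Fintype.ofFinite (K →ₗ[F] V)
  have := Fintype.ofFinite (K →ₗ[F] V × V)
  have := Fintype.ofFinite (Submodule F (V × V))
  set E : Finset (Fin n → K) := {G | ∃ T : K →ₗ[F] V, Function.Surjective T ∧
    T ∘ G ∈ permOrbit M} with hE
  have hsq := sum_sq_surjHits_le (F := F) (K := K) M
  have hpair := sum_pair_event_le M hk fun U h => (hU U h).le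
  have hZle := le_trans (Nat.mul_le_mul_left 2 (Nat.mul_le_mul_right _ hsq)) hpair
  rw [mul_comm 2 (n - _), pow_mul] at hZle
  have hzero : ∀ G ∉ E, surjHits (F := F) M G = 0 := by
    intro G hGE
    exact surjHits_eq_zero fun h => hGE (mem_filter.2 ⟨mem_univ _, h⟩)
  have hCS : (∑ G : Fin n → K, surjHits (F := F) M G) ^ 2 ≤
      #E * ∑ G : Fin n → K, surjHits (F := F) M G ^ 2 := by
    rw [← sum_subset (subset_univ E) fun G _ h => hzero G h]
    refine le_trans ?_ (Nat.mul_le_mul_left _ (sum_le_sum_of_subset (subset_univ E)))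
    exact sq_sum_le_card_mul_sum_sq
  have h1 := le_sum_surjHits (F := F) M hVK hk
  have h2 := lt_two_mul_of_moments (card_permOrbit_pos M) (pow_pos Nat.card_pos n) h1 hZle hCS
  rw [uniformProb_eq, Fintype.card_fun, Fintype.card_fin, ← Nat.card_eq_fintype_card,
    div_lt_iff₀ (by exact_mod_cast pow_pos Nat.card_pos n)] at hG
  have h3 : ((Nat.card K ^ n : ℕ) : ℝ) < ((2 * #E : ℕ) : ℝ) := by exact_mod_cast h2
  push_cast at h3 hG
  linarith

end SecondMoment

section Fourier

variable {F : Type*} [Field F]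

theorem exists_addChar_eq_traceChar [Finite F] :
    ∃ ψ : AddChar F ℂ, (∀ x, ψ x = traceChar x) ∧ ∀ a ≠ 0, ∃ c, ψ (a * c) ≠ 1 := by
  let _ : Algebra (ZMod (ringChar F)) F := ZMod.algebra F (ringChar F)
  have hp : ringChar F ≠ 0 := CharP.ringChar_ne_zero_of_finite F
  have : NeZero (ringChar F) := ⟨hp⟩
  have hζ := Complex.isPrimitiveRoot_exp (ringChar F) hp
  refine ⟨(AddChar.zmodChar (ringChar F) hζ.pow_eq_one).compAddMonoidHom
    (Algebra.trace (ZMod (ringChar F)) F).toAddMonoidHom, fun x => ?_, fun a ha => ?_⟩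
  · simp [AddChar.zmodChar_apply, traceChar]
  · obtain ⟨c, hc⟩ := FiniteField.trace_to_zmod_nondegenerate F ha
    refine ⟨c, fun h => hc ?_⟩
    rw [AddChar.compAddMonoidHom_apply, AddChar.zmodChar_apply, hζ.pow_eq_one_iff_dvd] at h
    have h0 := Nat.eq_zero_of_dvd_of_lt h (ZMod.val_lt _)
    rwa [ZMod.val_eq_zero] at h0

theorem card_mul_card_fiber_le [Finite F] {W : Type*} [AddCommGroup W] [Module F W] [Finite W]
    [DecidableEq W] {m : ℕ} {η : ℝ} (hη : 0 ≤ η) (u : Fin m → W)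
    (hu : ∀ f : W →ₗ[F] F, f ≠ 0 → IsBiasedVec η (f ∘ u)) (y : W) :
    (Nat.card W : ℝ) * #{x | u x = y} ≤ m * (1 + Nat.card W * η) := by
  obtain ⟨ψ, hψ, hnd⟩ := exists_addChar_eq_traceChar (F := F)
  have : Module.Finite F W := Module.Finite.of_finite
  have : Finite (W →ₗ[F] F) := Module.finite_of_finite F
  have := Fintype.ofFinite (W →ₗ[F] F)
  have hcard : Fintype.card (W →ₗ[F] F) = Nat.card W := by
    rw [← Nat.card_eq_fintype_card, Module.natCard_eq_pow_finrank (K := F),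
      Module.natCard_eq_pow_finrank (K := F) (V := W), Module.finrank_linearMap]
    simp
  have horth : ∀ w : W, ∑ f : W →ₗ[F] F, ψ (f w) = if w = 0 then (Nat.card W : ℂ) else 0 := by
    intro w
    split_ifs with hw
    · simp [hw, hcard]
    · obtain ⟨f, hf⟩ := Module.Projective.exists_dual_eq_one F hw
      obtain ⟨c, hc⟩ := hnd 1 one_ne_zero
      refine AddChar.sum_eq_zero_of_ne_one
        (ψ := ψ.compAddMonoidHom (LinearMap.applyₗ w : (W →ₗ[F] F) →ₗ[F] F).toAddMonoidHom)
        fun h => hc ?_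
      have := DFunLike.congr_fun h (c • f)
      simpa [hf] using this
  have hsum : (Nat.card W : ℂ) * #{x | u x = y} =
      ∑ f : W →ₗ[F] F, ψ (f (-y)) * ∑ x, traceChar (1 * (f ∘ u) x) := by
    simp_rw [mul_sum]
    rw [sum_comm]
    have : ∀ x, ∑ f : W →ₗ[F] F, ψ (f (-y)) * traceChar (1 * (f ∘ u) x) =
        if u x = y then (Nat.card W : ℂ) else 0 := by
      intro x
      simp_rw [← hψ, one_mul, Function.comp_apply, ← AddChar.map_add_eq_mul, ← map_add]
      rw [horth]
      simp [neg_add_eq_zero, eq_comm]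
    simp_rw [this]
    rw [sum_ite, sum_const, sum_const_zero, add_zero, nsmul_eq_mul, mul_comm]
  have hnorm : ∀ f : W →ₗ[F] F, ‖ψ (f (-y)) * ∑ x, traceChar (1 * (f ∘ u) x)‖ ≤
      (if f = 0 then (m : ℝ) else 0) + m * η := by
    intro f
    rw [norm_mul, AddChar.norm_apply, one_mul]
    split_ifs with hf
    · refine (norm_sum_le _ _).trans ?_
      simp_rw [← hψ, AddChar.norm_apply]
      simp only [sum_const, card_univ, Fintype.card_fin, nsmul_eq_mul, mul_one]
      have : 0 ≤ (m : ℝ) * η := by positivity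
      linarith
    · rw [zero_add]
      exact hu f hf 1 one_ne_zero
  calc (Nat.card W : ℝ) * #{x | u x = y} = ‖(Nat.card W : ℂ) * #{x | u x = y}‖ := by
        simp
    _ ≤ ∑ f : W →ₗ[F] F, ((if f = 0 then (m : ℝ) else 0) + m * η) := by
        rw [hsum]
        exact (norm_sum_le _ _).trans (sum_le_sum fun f _ => hnorm f)
    _ = _ := by
        rw [sum_add_distrib, sum_ite_eq' univ (0 : W →ₗ[F] F), sum_const, card_univ, hcard]
        simp
        ring

end Fourier

section Puncture

variable {F : Type*} [Field F] [Finite F] {W : Type*} [AddCommGroup W] [Module F W] [Finite W]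

theorem card_comp_eq_le {m n : ℕ} {η : ℝ} (hη : 0 ≤ η) (u : Fin m → W)
    (hu : ∀ f : W →ₗ[F] F, f ≠ 0 → IsBiasedVec η (f ∘ u)) (N : Fin n → W) :
    (#{i : Fin n → Fin m | u ∘ i = N} : ℝ) ≤
      (m : ℝ) ^ n * ((1 + Nat.card W * η) / Nat.card W) ^ n := by
  have hW : (0 : ℝ) < Nat.card W := by exact_mod_cast Nat.card_pos
  rw [card_comp_eq]
  push_cast
  calc _ ≤ ∏ _s : Fin n, ((m : ℝ) * ((1 + Nat.card W * η) / Nat.card W)) := by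
        refine prod_le_prod (fun _ _ => by positivity) fun s _ => ?_
        have := card_mul_card_fiber_le (F := F) hη u hu (N s)
        rw [← mul_div_assoc, le_div_iff₀ hW]
        linarith
    _ = _ := by simp [mul_pow]

theorem uniformProb_orbit_le_puncture {m n j : ℕ} {η : ℝ} (hη : 0 ≤ η)
    (D : Submodule F (Fin m → F)) (hD : IsBiased η D) (e : Module.Basis (Fin j) F W)
    (M : Fin n → W) (hM : Submodule.span F (Set.range M) = ⊤) :
    uniformProb (fun i : Fin n → Fin m =>
        ∃ N ∈ permOrbit M, ∀ f : W →ₗ[F] F, f ∘ N ∈ puncture D i) ≤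
      (Nat.card D : ℝ) ^ j * #(permOrbit M) * ((1 + Nat.card W * η) / Nat.card W) ^ n := by
  have hW : (0 : ℝ) < Nat.card W := by exact_mod_cast Nat.card_pos
  rcases (pow_nonneg m.cast_nonneg n : (0 : ℝ) ≤ (m : ℝ) ^ n).eq_or_lt with hmn | hmn
  · rw [uniformProb, Fintype.card_fun, Fintype.card_fin, Fintype.card_fin, Nat.cast_pow, ← hmn,
      div_zero]
    positivity
  have := Fintype.ofFinite D
  let u : (Fin j → D) → Fin m → W := fun c x => ∑ l, (c l : Fin m → F) x • e l
  have hfu : ∀ c (f : W →ₗ[F] F), f ∘ u c ∈ D := by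
    intro c f
    have : f ∘ u c = ∑ l, f (e l) • (c l : Fin m → F) := by
      ext x
      simp [u, mul_comm]
    rw [this]
    exact D.sum_mem fun l _ => D.smul_mem _ (c l).2
  have hsub : ({i : Fin n → Fin m | ∃ N ∈ permOrbit M, ∀ f : W →ₗ[F] F, f ∘ N ∈ puncture D i} :
      Finset _) ⊆ (univ ×ˢ permOrbit M).biUnion fun cN : (Fin j → D) × (Fin n → W) =>
        ({i : Fin n → Fin m | u cN.1 ∘ i = cN.2} : Finset _) := by
    intro i hi
    simp only [mem_filter, mem_univ, true_and, mem_biUnion, mem_product, Prod.exists] at hi ⊢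
    obtain ⟨N, hN, hi⟩ := hi
    have : ∀ l, ∃ d : D, ∀ s, (d : Fin m → F) (i s) = e.coord l (N s) := by
      intro l
      obtain ⟨d, hd, hdi⟩ := hi (e.coord l)
      exact ⟨⟨d, hd⟩, fun s => congrFun hdi s⟩
    choose c hc using this
    refine ⟨c, N, hN, funext fun s => ?_⟩
    simp only [u, Function.comp_apply, hc]
    exact e.sum_repr (N s)
  have hterm : ∀ cN ∈ (univ ×ˢ permOrbit M : Finset ((Fin j → D) × (Fin n → W))),
      (#{i : Fin n → Fin m | u cN.1 ∘ i = cN.2} : ℝ) ≤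
        (m : ℝ) ^ n * ((1 + Nat.card W * η) / Nat.card W) ^ n := by
    rintro ⟨c, N⟩ hcN
    have hN := (mem_product.1 hcN).2
    by_cases hex : ∃ i, u c ∘ i = N
    · obtain ⟨i, hi⟩ := hex
      refine card_comp_eq_le hη (u c) (fun f hf => hD _ (hfu c f) fun h0 => hf ?_) N
      obtain ⟨π, hπ⟩ := mem_permOrbit.1 hN
      refine LinearMap.ext_on_range hM fun s => ?_
      have h1 : M s = u c (i (π.symm s)) := by
        have := congrFun (hπ.trans hi.symm) (π.symm s)
        simpa using this
      rw [h1]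
      exact congrFun h0 _
    · rw [filter_eq_empty_iff.2 fun i _ h => hex ⟨i, h⟩, card_empty, Nat.cast_zero]
      positivity
  rw [uniformProb_eq, Fintype.card_fun, Fintype.card_fin, Fintype.card_fin, Nat.cast_pow,
    div_le_iff₀ hmn]
  calc _ ≤ ∑ cN ∈ (univ ×ˢ permOrbit M : Finset ((Fin j → D) × (Fin n → W))),
        (#{i : Fin n → Fin m | u cN.1 ∘ i = cN.2} : ℝ) := by
        exact_mod_cast (card_le_card hsub).trans card_biUnion_le
    _ ≤ _ := sum_le_card_nsmul _ _ _ hterm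
    _ = _ := by
        rw [card_product, card_univ, Fintype.card_fun, Fintype.card_fin, nsmul_eq_mul,
          Nat.card_eq_fintype_card (α := D)]
        push_cast
        ring

end Puncture

section Probability

theorem uniformProb_le_of_equiv {Ω Ω' : Type*} [Fintype Ω] [Fintype Ω'] (σ : Ω ≃ Ω')
    {E : Ω → Prop} {E' : Ω' → Prop} (h : ∀ ω, E ω → E' (σ ω)) :
    uniformProb E ≤ uniformProb E' := by
  rw [uniformProb, uniformProb, Fintype.card_congr σ]
  refine div_le_div_of_nonneg_right ?_ (Nat.cast_nonneg _)
  exact_mod_cast Nat.card_le_card_of_injective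
    (fun ω : {ω // E ω} => (⟨σ ω.1, h _ ω.2⟩ : {ω // E' ω}))
    fun a c hac => Subtype.ext (σ.injective (congrArg Subtype.val hac))

theorem uniformProb_mono {Ω : Type*} [Fintype Ω] {E E' : Ω → Prop} (h : ∀ ω, E ω → E' ω) :
    uniformProb E ≤ uniformProb E' :=
  uniformProb_le_of_equiv (Equiv.refl Ω) h

theorem uniformProb_le_one {Ω : Type*} [Fintype Ω] (E : Ω → Prop) : uniformProb E ≤ 1 := by
  rw [uniformProb_eq]
  exact div_le_one_of_le₀ (by exact_mod_cast card_le_univ _) (Nat.cast_nonneg _)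

theorem uniformProb_le_card_mul {Ω κ : Type*} [Fintype Ω] [Fintype κ] {E : Ω → Prop}
    (A : κ → Ω → Prop) (hE : ∀ ω, E ω → ∃ c, A c ω) {β : ℝ} (hA : ∀ c, uniformProb (A c) ≤ β) :
    uniformProb E ≤ Fintype.card κ * β := by
  have hcard : #{ω | E ω} ≤ ∑ c, #{ω | A c ω} := by
    refine le_trans (card_le_card fun ω hω => ?_) card_biUnion_le
    obtain ⟨c, hc⟩ := hE ω (mem_filter.1 hω).2
    exact mem_biUnion.2 ⟨c, mem_univ _, mem_filter.2 ⟨mem_univ _, hc⟩⟩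
  calc uniformProb E ≤ ∑ c, uniformProb (A c) := by
        simp_rw [uniformProb_eq, ← sum_div]
        exact div_le_div_of_nonneg_right (by exact_mod_cast hcard) (Nat.cast_nonneg _)
    _ ≤ ∑ _c : κ, β := sum_le_sum fun c _ => hA c
    _ = _ := by simp

end Probability

section ColumnSpace

variable {F : Type*} [Field F]

/-- The span of the columns of the matrix whose rows are `M`. -/
def colSpace {n b : ℕ} (M : Fin n → Fin b → F) : Submodule F (Fin n → F) :=
  Submodule.span F (Set.range (Function.swap M))

theorem comp_mem_colSpace {n b : ℕ} (M : Fin n → Fin b → F) (f : (Fin b → F) →ₗ[F] F) :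
    f ∘ M ∈ colSpace M := by
  have : f ∘ M = ∑ l, f (fun s => if l = s then 1 else 0) • Function.swap M l := by
    ext i
    simp only [Function.comp_apply, Finset.sum_apply, Pi.smul_apply, smul_eq_mul]
    rw [f.pi_apply_eq_sum_univ]
    exact sum_congr rfl fun l _ => mul_comm _ _
  rw [this]
  exact Submodule.sum_mem _ fun l _ =>
    Submodule.smul_mem _ _ (Submodule.subset_span (Set.mem_range_self l))

theorem colSpace_comp_perm_mem {n b : ℕ} {P : Set (Submodule F (Fin n → F))}
    (hP : IsRowSymmetric P) {M : Fin n → Fin b → F} (hM : colSpace M ∈ P)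
    (π : Equiv.Perm (Fin n)) : colSpace (M ∘ π) ∈ P := by
  have := hP _ hM π
  rw [colSpace, Submodule.map_span, ← Set.range_comp] at this
  exact this

/-- The numbers of occurrences of the values of `M`. -/
noncomputable def fiberCounts {n : ℕ} {V : Type*} (M : Fin n → V) (v : V) : Fin (n + 1) :=
  ⟨#{i | M i = v}, Nat.lt_succ_of_le ((card_le_univ _).trans (Fintype.card_fin n).le)⟩

theorem mem_permOrbit_of_fiberCounts_eq {n : ℕ} {V : Type*} {M N : Fin n → V}
    (h : fiberCounts M = fiberCounts N) : N ∈ permOrbit M := by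
  have hc : ∀ v, Nonempty ({i // N i = v} ≃ {i // M i = v}) := fun v => by
    refine ⟨Fintype.equivOfCardEq ?_⟩
    rw [Fintype.card_subtype, Fintype.card_subtype]
    exact (congrArg Fin.val (congrFun h v)).symm
  exact mem_permOrbit.2 ⟨Equiv.ofFiberEquiv fun v => (hc v).some,
    funext fun i => Equiv.ofFiberEquiv_map _ i⟩

theorem exists_colSpace_of_isLocal {n b : ℕ} {P : Set (Submodule F (Fin n → F))}
    (hP : IsLocal b P) {C : Submodule F (Fin n → F)} (hC : C ∈ P) :
    ∃ M : Fin n → Fin b → F, colSpace M ∈ P ∧ colSpace M ≤ C := by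
  obtain ⟨𝓑, hcard, h𝓑⟩ := hP
  obtain ⟨B, hB, hBC⟩ := (h𝓑 C).1 hC
  let g : Fin b → Fin n → F := fun l =>
    if h : (l : ℕ) < #B then (B.equivFin.symm ⟨l, h⟩ : Fin n → F) else 0
  refine ⟨Function.swap g, (h𝓑 _).2 ⟨B, hB, fun x hx => Submodule.subset_span ?_⟩,
    Submodule.span_le.2 ?_⟩
  · refine ⟨⟨B.equivFin ⟨x, hx⟩, (B.equivFin ⟨x, hx⟩).2.trans_le (hcard B hB)⟩, ?_⟩
    change g _ = x
    simp [g]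
  · rintro _ ⟨l, rfl⟩
    change g l ∈ C
    by_cases h : (l : ℕ) < #B
    · simp only [g, h, dite_true]
      exact hBC (B.equivFin.symm ⟨l, h⟩).2
    · simp [g, h]

end ColumnSpace

section Bound

variable {F : Type*} [Field F] [Fintype F]

theorem uniformProb_surj_le_rlcProb {n b k : ℕ} {P : Set (Submodule F (Fin n → F))}
    (hup : IsUpperSet P) (hsym : IsRowSymmetric P) {M : Fin n → Fin b → F} (hM : colSpace M ∈ P)
    {V : Submodule F (Fin b → F)} (M₁ : Fin n → V) (hM₁ : ∀ i, (M₁ i : Fin b → F) = M i) :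
    uniformProb (fun G : Fin n → Fin k → F => ∃ T : (Fin k → F) →ₗ[F] V,
      Function.Surjective T ∧ T ∘ G ∈ permOrbit M₁) ≤ rlcProb k P := by
  refine uniformProb_le_of_equiv (Equiv.piComm fun _ _ => F) ?_
  rintro G ⟨T, -, hT⟩
  obtain ⟨π, hπ⟩ := mem_permOrbit.1 hT
  refine hup ?_ (colSpace_comp_perm_mem hsym hM π)
  refine Submodule.span_le.2 ?_
  rintro _ ⟨l, rfl⟩
  have : Function.swap (M ∘ π) l = (LinearMap.proj l ∘ₗ V.subtype ∘ₗ T) ∘ G := by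
    ext i
    have := congrArg Subtype.val (congrFun hπ i)
    simp only [Function.comp_apply, hM₁] at this
    simp [Function.swap, this]
  rw [this]
  exact comp_mem_colSpace G _

theorem exists_uniformProb_orbit_le {n m b k : ℕ} {P : Set (Submodule F (Fin n → F))}
    (hup : IsUpperSet P) (hsym : IsRowSymmetric P) {M : Fin n → Fin b → F} (hM : colSpace M ∈ P)
    (hbk : b + 3 ≤ k) (hkn : k ≤ n) (hrlc : rlcProb k P < 1 / 2) {η : ℝ} (hη : 0 ≤ η)
    (D : Submodule F (Fin m → F)) (hD : IsBiased η D) :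
    ∃ j : ℕ, 1 ≤ j ∧ j ≤ b ∧
      uniformProb (fun i : Fin n → Fin m => ∃ N ∈ permOrbit M, colSpace N ≤ puncture D i) ≤
        (Nat.card D : ℝ) ^ j * (2 * (Fintype.card F : ℝ) ^ (4 * b ^ 2) *
          ((Fintype.card F : ℝ) ^ j) ^ (n - k)) *
          ((1 + (Fintype.card F : ℝ) ^ j * η) / (Fintype.card F : ℝ) ^ j) ^ n := by
  set q := Fintype.card F with hq
  have hq1 : 2 ≤ q := Fintype.one_lt_card
  set V := Submodule.span F (Set.range M) with hV
  let M₁ : Fin n → V := fun i => ⟨M i, Submodule.subset_span (Set.mem_range_self i)⟩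
  have hspan : Submodule.span F (Set.range M₁) = ⊤ := by
    rw [eq_top_iff, ← Submodule.map_le_map_iff_of_injective V.injective_subtype,
      Submodule.map_span, ← Set.range_comp, Submodule.map_top, Submodule.range_subtype]
    exact le_rfl
  have hd : Module.finrank F V ≤ b := (Submodule.finrank_le V).trans (by simp)
  have hVcard : Nat.card V = q ^ Module.finrank F V := by
    rw [Module.natCard_eq_pow_finrank (K := F), Nat.card_eq_fintype_card (α := F)]
  have hVK : 8 * Nat.card V ≤ Nat.card (Fin k → F) := by
    rw [Nat.card_fun, Nat.card_eq_fintype_card (α := F), Nat.card_fin, hVcard]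
    calc 8 * q ^ Module.finrank F V ≤ q ^ 3 * q ^ b :=
          Nat.mul_le_mul (Nat.pow_le_pow_left hq1 3) (Nat.pow_le_pow_right (by omega) hd)
      _ = q ^ (b + 3) := by ring
      _ ≤ q ^ k := Nat.pow_le_pow_right (by omega) hbk
  obtain ⟨U, hU, hUcard⟩ := exists_quotient_card_permOrbit_le (F := F) (K := Fin k → F) M₁ hVK
    (by simpa using hkn)
    ((uniformProb_surj_le_rlcProb hup hsym hM M₁ fun _ => rfl).trans_lt hrlc)
  rw [Module.finrank_fin_fun] at hUcard
  have hne : Nontrivial (V ⧸ U) := Submodule.Quotient.nontrivial_iff.2 hU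
  set j := Module.finrank F (V ⧸ U) with hj
  have hjd : j ≤ Module.finrank F V := U.finrank_quotient_le
  have hWcard : Nat.card (V ⧸ U) = q ^ j := by
    rw [Module.natCard_eq_pow_finrank (K := F), Nat.card_eq_fintype_card (α := F)]
  have hsub : Nat.card (Submodule F (V × V)) ≤ q ^ (4 * b ^ 2) := by
    refine card_submodule_le.trans ?_
    rw [Nat.card_prod, hVcard, Module.finrank_prod, ← pow_add, ← pow_mul]
    refine Nat.pow_le_pow_right (by omega) ?_
    nlinarith
  have hspan' : Submodule.span F (Set.range (U.mkQ ∘ M₁)) = ⊤ := by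
    rw [Set.range_comp, ← Submodule.map_span, hspan, Submodule.map_top, Submodule.range_mkQ]
  refine ⟨j, Module.finrank_pos, hjd.trans hd, ?_⟩
  refine (uniformProb_mono ?_).trans ((uniformProb_orbit_le_puncture hη D hD
    (Module.finBasis F (V ⧸ U)) (U.mkQ ∘ M₁) hspan').trans ?_)
  · rintro i ⟨N, hN, hNi⟩
    obtain ⟨π, rfl⟩ := mem_permOrbit.1 hN
    refine ⟨(U.mkQ ∘ M₁) ∘ π, mem_permOrbit.2 ⟨π, rfl⟩, fun f => hNi ?_⟩
    obtain ⟨g, hg⟩ := LinearMap.exists_extend (f ∘ₗ U.mkQ)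
    have : f ∘ (U.mkQ ∘ M₁) ∘ π = g ∘ (M ∘ π) := by
      ext s
      exact (LinearMap.congr_fun hg (M₁ (π s))).symm
    rw [this]
    exact comp_mem_colSpace _ g
  · rw [hWcard]
    push_cast
    refine mul_le_mul_of_nonneg_right (mul_le_mul_of_nonneg_left ?_ (by positivity))
      (by positivity)
    calc (#(permOrbit (U.mkQ ∘ M₁)) : ℝ)
        ≤ ((2 * Nat.card (Submodule F (V × V)) * Nat.card (V ⧸ U) ^ (n - k) : ℕ) : ℝ) := by
          exact_mod_cast hUcard
      _ ≤ ((2 * q ^ (4 * b ^ 2) * (q ^ j) ^ (n - k) : ℕ) : ℝ) := by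
          rw [hWcard]
          exact_mod_cast Nat.mul_le_mul_right _ (Nat.mul_le_mul_left _ hsub)
      _ = _ := by push_cast; rfl

theorem puncturingProb_le {n m b : ℕ} {P : Set (Submodule F (Fin n → F))} (hloc : IsLocal b P)
    (D : Submodule F (Fin m → F)) {β : ℝ} (hβ : 0 ≤ β)
    (h : ∀ M : Fin n → Fin b → F, colSpace M ∈ P →
      uniformProb (fun i : Fin n → Fin m => ∃ N ∈ permOrbit M, colSpace N ≤ puncture D i) ≤ β) :
    puncturingProb D P ≤ ((n : ℝ) + 1) ^ (Fintype.card F ^ b) * β := by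
  have := uniformProb_le_card_mul (β := β) (E := fun i : Fin n → Fin m => puncture D i ∈ P)
    (fun (c : (Fin b → F) → Fin (n + 1)) i => ∃ M : Fin n → Fin b → F,
      colSpace M ∈ P ∧ fiberCounts M = c ∧ colSpace M ≤ puncture D i) ?_ ?_
  · simpa [puncturingProb] using this
  · intro i hi
    obtain ⟨M, hM, hMi⟩ := exists_colSpace_of_isLocal hloc hi
    exact ⟨_, M, hM, rfl, hMi⟩
  · intro c
    by_cases hc : ∃ M : Fin n → Fin b → F, colSpace M ∈ P ∧ fiberCounts M = c
    · obtain ⟨M, hM, rfl⟩ := hc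
      refine (uniformProb_mono ?_).trans (h M hM)
      rintro i ⟨N, -, hN, hNi⟩
      exact ⟨N, mem_permOrbit_of_fiberCounts_eq hN.symm, hNi⟩
    · rw [uniformProb_eq, filter_eq_empty_iff.2 fun i _ ⟨M, h1, h2, _⟩ => hc ⟨M, h1, h2⟩]
      simpa using hβ

theorem rlcProb_lt_half {n k : ℕ} {P : Set (Submodule F (Fin n → F))} (hn : 0 < n)
    (hk : (k : ℝ) < rlcThreshold P * n) (hkn : k ≤ n) : rlcProb k P < 1 / 2 := by
  by_contra! h
  have hn' : (0 : ℝ) < n := by exact_mod_cast hn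
  refine absurd hk (not_lt.2 ?_)
  rw [← le_div_iff₀ hn']
  refine csInf_le ⟨0, ?_⟩ (Set.mem_insert_of_mem _ ⟨⟨by positivity, ?_⟩, k, ?_, h⟩)
  · rintro R (rfl | hR)
    · exact zero_le_one
    · exact hR.1.1
  · exact div_le_one_of_le₀ (by exact_mod_cast hkn) hn'.le
  · field_simp

theorem rlcThreshold_le_one {n : ℕ} (P : Set (Submodule F (Fin n → F))) :
    rlcThreshold P ≤ 1 := by
  refine csInf_le ⟨0, ?_⟩ (Set.mem_insert _ _)
  rintro R (rfl | hR)
  · exact zero_le_one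
  · exact hR.1.1

theorem designRate_nonneg {m : ℕ} (D : Submodule F (Fin m → F)) (n : ℕ) :
    0 ≤ designRate D n := by
  refine div_nonneg (Real.logb_nonneg ?_ ?_) n.cast_nonneg
  · exact_mod_cast Fintype.one_lt_card
  · exact_mod_cast (Nat.card_pos : 0 < Nat.card D)

end Bound

section Estimates

theorem mul_pow_le_mul_pow {q j b : ℕ} (hq : 2 ≤ q) (hj : 1 ≤ j) (hjb : j ≤ b) :
    b * q ^ j ≤ j * q ^ b := by
  induction b, hjb using Nat.le_induction with
  | base => exact le_rfl
  | succ b hb ih =>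
    calc (b + 1) * q ^ j ≤ (2 * b) * q ^ j := Nat.mul_le_mul_right _ (by omega)
      _ = 2 * (b * q ^ j) := by ring
      _ ≤ q * (j * q ^ b) := Nat.mul_le_mul hq ih
      _ = _ := by ring

theorem orbit_bound_le_rpow {q n j b k : ℕ} {R ε : ℝ} (hq : 2 ≤ q) (hj : 1 ≤ j) (hjb : j ≤ b)
    (hkn : k ≤ n) (hε : 0 < ε) (hk : R * n - 1 + 2 * ε * n ≤ k) :
    ((q : ℝ) ^ (R * n)) ^ j * (2 * (q : ℝ) ^ (4 * b ^ 2) * ((q : ℝ) ^ j) ^ (n - k)) *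
        ((1 + (q : ℝ) ^ j * (ε * b * Real.log q / (q : ℝ) ^ b)) / (q : ℝ) ^ j) ^ n ≤
      (q : ℝ) ^ (4 * (b : ℝ) ^ 2 + 1 + b - ε * n) := by
  have hq2 : (2 : ℝ) ≤ q := by exact_mod_cast hq
  have hq0 : (0 : ℝ) < q := by linarith
  have hL : 0 < Real.log q := Real.log_pos (by linarith)
  have hη : (q : ℝ) ^ j * (ε * b * Real.log q / (q : ℝ) ^ b) ≤ Real.log q * (ε * j) := by
    rw [← mul_div_assoc, div_le_iff₀ (by positivity)]
    have h : (b : ℝ) * (q : ℝ) ^ j ≤ j * (q : ℝ) ^ b := by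
      exact_mod_cast mul_pow_le_mul_pow hq hj hjb
    nlinarith [mul_le_mul_of_nonneg_left h (mul_pos hL hε).le]
  have h1 : (1 + (q : ℝ) ^ j * (ε * b * Real.log q / (q : ℝ) ^ b)) ^ n ≤
      (q : ℝ) ^ (ε * j * n) := by
    calc _ ≤ (Real.exp (Real.log q * (ε * j))) ^ n := by
          refine pow_le_pow_left₀ (by positivity) ?_ n
          linarith [Real.add_one_le_exp (Real.log q * (ε * j))]
      _ = _ := by rw [← Real.rpow_def_of_pos hq0, ← Real.rpow_mul_natCast hq0.le]
  have h2 : (2 : ℝ) * (q : ℝ) ^ (4 * b ^ 2) ≤ (q : ℝ) ^ (4 * (b : ℝ) ^ 2 + 1) := by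
    have : (4 * (b : ℝ) ^ 2 + 1) = ((4 * b ^ 2 + 1 : ℕ) : ℝ) := by push_cast; ring
    rw [this, Real.rpow_natCast, pow_succ, mul_comm]
    exact mul_le_mul_of_nonneg_left hq2 (by positivity)
  have h3 : ((q : ℝ) ^ j) ^ (n - k) / ((q : ℝ) ^ j) ^ n = (q : ℝ) ^ (-(j * k : ℝ)) := by
    rw [div_eq_iff (by positivity), Real.rpow_neg hq0.le, ← Nat.cast_mul, Real.rpow_natCast,
      pow_mul, eq_inv_mul_iff_mul_eq₀ (by positivity), ← pow_add, Nat.add_sub_cancel' hkn]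
  have hj' : (1 : ℝ) ≤ j := by exact_mod_cast hj
  have hjb' : (j : ℝ) ≤ b := by exact_mod_cast hjb
  calc _ = (q : ℝ) ^ (R * n * j) * (2 * (q : ℝ) ^ (4 * b ^ 2)) *
        (((q : ℝ) ^ j) ^ (n - k) / ((q : ℝ) ^ j) ^ n) *
        (1 + (q : ℝ) ^ j * (ε * b * Real.log q / (q : ℝ) ^ b)) ^ n := by
        rw [div_pow, ← Real.rpow_mul_natCast hq0.le (R * n)]
        generalize (q : ℝ) ^ (R * n * j) = x
        ring
    _ ≤ (q : ℝ) ^ (R * n * j) * (q : ℝ) ^ (4 * (b : ℝ) ^ 2 + 1) * (q : ℝ) ^ (-(j * k : ℝ)) *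
        (q : ℝ) ^ (ε * j * n) := by
        rw [h3]
        gcongr
    _ = (q : ℝ) ^ (R * n * j + (4 * (b : ℝ) ^ 2 + 1) + -(j * k : ℝ) + ε * j * n) := by
        rw [Real.rpow_add hq0 _ (ε * j * n), Real.rpow_add hq0 _ (-(j * k : ℝ)),
          Real.rpow_add hq0 (R * n * j)]
    _ ≤ _ := by
        refine Real.rpow_le_rpow_of_exponent_le (by linarith) ?_
        have e1 : (j : ℝ) * (R * n - 1 + 2 * ε * n) ≤ j * k :=
          mul_le_mul_of_nonneg_left hk (by linarith)
        have e2 : 1 * (ε * n) ≤ j * (ε * n) := mul_le_mul_of_nonneg_right hj' (by positivity)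
        nlinarith

theorem half_le_log {x : ℝ} (hx : 2 ≤ x) : 1 / 2 ≤ Real.log x := by
  have := Real.log_two_gt_d9
  have := Real.log_le_log two_pos hx
  linarith

theorem sq_le_four_pow (b : ℕ) : b ^ 2 ≤ 4 ^ b := by
  calc b ^ 2 ≤ (2 ^ b) ^ 2 := Nat.pow_le_pow_left b.lt_two_pow_self.le 2
    _ = 4 ^ b := by rw [← pow_mul, mul_comm, pow_mul]; norm_num

theorem add_le_of_le_div_log {q n b : ℕ} {c : ℝ} (hq : 2 ≤ q) (hn : 2 ≤ n) (hc : 0 < c)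
    (h : c * (q : ℝ) ^ (2 * b) ≤ n / Real.log n) :
    Real.logb q (n + 1) * (q : ℝ) ^ b + (4 * (b : ℝ) ^ 2 + 1 + b) ≤ 16 / c * n ∧
      (b : ℝ) + 4 ≤ 16 / c * n := by
  have hq2 : (2 : ℝ) ≤ q := by exact_mod_cast hq
  have hn2 : (2 : ℝ) ≤ n := by exact_mod_cast hn
  have hlq := half_le_log hq2
  have hln := half_le_log hn2
  set Q : ℝ := (q : ℝ) ^ (2 * b) with hQ
  have hQn : Q * Real.log n ≤ n / c := by
    rw [le_div_iff₀ (by linarith)] at h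
    rw [le_div_iff₀ hc]
    linarith
  have hQ1 : 1 ≤ Q := one_le_pow₀ (by linarith)
  have hb2 : (b : ℝ) ^ 2 ≤ Q := by
    have h4 : (b : ℝ) ^ 2 ≤ 4 ^ b := by exact_mod_cast sq_le_four_pow b
    refine h4.trans ?_
    rw [hQ, pow_mul]
    exact pow_le_pow_left₀ (by norm_num) (by nlinarith) b
  have hb : (b : ℝ) ≤ Q := by
    refine le_trans ?_ hb2
    exact_mod_cast Nat.le_self_pow two_ne_zero b
  have hqb : (q : ℝ) ^ b ≤ Q := pow_le_pow_right₀ (by linarith) (by omega)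
  have hlog1 : Real.log (n + 1) ≤ 2 * Real.log n := by
    rw [← Real.log_rpow (by linarith), show (2 : ℝ) = (2 : ℕ) by norm_num, Real.rpow_natCast]
    exact Real.log_le_log (by linarith) (by nlinarith)
  have hlogb : Real.logb q (n + 1) ≤ 4 * Real.log n := by
    rw [Real.logb, div_le_iff₀ (by linarith)]
    nlinarith
  have hfirst : Real.logb q (n + 1) * (q : ℝ) ^ b ≤ 4 * (Q * Real.log n) := by
    calc _ ≤ 4 * Real.log n * Q := mul_le_mul hlogb hqb (by positivity) (by linarith)
      _ = _ := by ring
  have hQlog : Q ≤ 2 * (Q * Real.log n) := by nlinarith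
  have h16 : 16 / c * n = 16 * (n / c) := by ring
  rw [h16]
  constructor <;> linarith

end Estimates

end PuncturedCodes

theorem mainTheorem1 (w : ℕ → ℝ) (hw : Tendsto w atTop atTop) :
    ∃ δ : ℕ → ℝ, Tendsto δ atTop (𝓝 0) ∧
      ∀ (F : Type*) [Field F] [Fintype F] (n m b : ℕ)
        (P : Set (Submodule F (Fin n → F))) (D : Submodule F (Fin m → F)) (ε : ℝ),
        IsUpperSet P → PuncturedCodes.IsRowSymmetric P → PuncturedCodes.IsLocal b P →
        w n * (Fintype.card F : ℝ) ^ (2 * b) ≤ (n : ℝ) / Real.log n →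
        0 < ε →
        PuncturedCodes.IsBiased
          (ε * b * Real.log (Fintype.card F) / (Fintype.card F : ℝ) ^ b) D →
        PuncturedCodes.designRate D n ≤ PuncturedCodes.rlcThreshold P - 2 * ε →
        PuncturedCodes.puncturingProb D P ≤
          (Fintype.card F : ℝ) ^ (-(ε - δ n) * (n : ℝ)) := by
  refine ⟨fun n => if 0 < w n ∧ 2 ≤ n then 16 / w n else 1, ?_, ?_⟩
  · refine (hw.const_div_atTop 16).congr' ?_
    filter_upwards [hw.eventually_gt_atTop 0, eventually_ge_atTop 2] with n h1 h2
    rw [if_pos ⟨h1, h2⟩]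
  intro F _ _ n m b P D ε hup hsym hloc hwn hε hD hR
  have hq : 2 ≤ Fintype.card F := Fintype.one_lt_card
  set q := Fintype.card F with hq_def
  have hq2 : (2 : ℝ) ≤ q := by exact_mod_cast hq
  have hq0 : (0 : ℝ) < q := by linarith
  have htriv : ∀ d : ℝ, ε * n ≤ d * n →
      PuncturedCodes.puncturingProb D P ≤ (q : ℝ) ^ (-(ε - d) * (n : ℝ)) := fun d hd =>
    (PuncturedCodes.uniformProb_le_one _).trans
      (Real.one_le_rpow (by linarith) (by linarith))
  have hR0 := PuncturedCodes.designRate_nonneg D n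
  have hRLC := PuncturedCodes.rlcThreshold_le_one P
  dsimp only
  split_ifs with hcase
  swap
  · exact htriv 1 (mul_le_mul_of_nonneg_right (by linarith) n.cast_nonneg)
  obtain ⟨hw0, hn2⟩ := hcase
  have hn0 : (0 : ℝ) < n := by exact_mod_cast (by omega : 0 < n)
  obtain ⟨hδ, hδb⟩ := PuncturedCodes.add_le_of_le_div_log hq hn2 hw0 hwn
  set t := PuncturedCodes.rlcThreshold P * n with ht
  have hRn : PuncturedCodes.designRate D n * n + 2 * ε * n ≤ t := by
    rw [ht]
    nlinarith
  rcases le_or_gt t (b + 4) with htb | htb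
  · refine htriv _ ?_
    have : 0 ≤ PuncturedCodes.designRate D n * n := by positivity
    have : 0 < ε * n := by positivity
    linarith
  obtain ⟨k, hk⟩ : ∃ k, ⌈t⌉₊ = k + 1 :=
    Nat.exists_eq_succ_of_ne_zero (Nat.ceil_pos.2 (by linarith [b.cast_nonneg (α := ℝ)])).ne'
  have htk : t ≤ k + 1 := by exact_mod_cast hk ▸ Nat.le_ceil t
  have hkt : (k : ℝ) < t := Nat.lt_ceil.1 (by omega)
  have hkn : k ≤ n := by
    have : (k : ℝ) ≤ n := hkt.le.trans (mul_le_of_le_one_left hn0.le hRLC)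
    exact_mod_cast this
  have hbk : b + 3 ≤ k := by
    have : ((b + 3 : ℕ) : ℝ) ≤ k := by push_cast; linarith
    exact_mod_cast this
  have hcardD : (Nat.card D : ℝ) = (q : ℝ) ^ (PuncturedCodes.designRate D n * n) := by
    have : (0 : ℝ) < Nat.card D := by exact_mod_cast (Nat.card_pos : 0 < Nat.card D)
    rw [PuncturedCodes.designRate, div_mul_cancel₀ _ hn0.ne',
      Real.rpow_logb hq0 (by linarith) this]
  have hη : 0 ≤ ε * b * Real.log q / (q : ℝ) ^ b := by
    have := Real.log_nonneg (by linarith : (1 : ℝ) ≤ q)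
    positivity
  have hbound := PuncturedCodes.puncturingProb_le hloc D
    (β := (q : ℝ) ^ (4 * (b : ℝ) ^ 2 + 1 + b - ε * n)) (by positivity) fun M hM => by
      obtain ⟨j, hj1, hjb, hj⟩ := PuncturedCodes.exists_uniformProb_orbit_le hup hsym hM hbk hkn
        (PuncturedCodes.rlcProb_lt_half (by omega) hkt hkn) hη D hD
      rw [hcardD] at hj
      exact hj.trans (PuncturedCodes.orbit_bound_le_rpow hq hj1 hjb hkn hε (by linarith))
  refine hbound.trans ?_
  have hn1 : ((n : ℝ) + 1) ^ (q ^ b) = (q : ℝ) ^ (Real.logb q (n + 1) * (q : ℝ) ^ b) := by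
    rw [Real.rpow_mul hq0.le, Real.rpow_logb hq0 (by linarith) (by linarith),
      ← Nat.cast_pow, Real.rpow_natCast]
  rw [← hq_def, hn1, ← Real.rpow_add hq0]
  exact Real.rpow_le_rpow_of_exponent_le (by linarith) (by linarith)
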